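/- Let $X$ be a Polish space and let $\mathcal P=(X,d,(x_i)_{i\in\omega})$ be a presentation of $X$, i.e. $d$ is a complete metric compatible with the topology of $X$ and $(x_i)_{i\in\omega}$ is a dense sequence in $X$. Let $F(X)$ be the Effros Borel space of closed subsets of $X$, whose $\sigma$-algebra is generated by the sets $\{F\in F(X)\mid F\cap U\neq\emptyset\}$ with $U\subseteq X$ open, and let $F_{\aleph_0}(X)\subseteq F(X)$ be the set of countable closed subsets (finite sets and $\emptyset$ included). For $n=(n(0),n(1))\in\omega^2$ let $B_{\mathcal P}(n)=\{x\in X\mid d(x,x_{n(0)})<2^{-n(1)-1}\}$ and $\overline B_{\mathcal P}(n)=\{x\in X\mid d(x,x_{n(0)})\le 2^{-n(1)-1}\}$. For $n,m\in\omega^2$ write $n\prec_{\mathcal P}m$ if $n(1)<m(1)$ and $\overline B_{\mathcal P}(m)\subseteq B_{\mathcal P}(n)$, and write $n\curlywedge_{\mathcal P}m$ if $\overline B_{\mathcal P}(n)\cap\overline B_{\mathcal P}(m)=\emptyset$. For $A\subseteq\omega^2$ put $$D_{\mathcal P}(A)=\{n\in A\mid \exists u,v\in A:\ n\prec_{\mathcal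 P}u,\ n\prec_{\mathcal P}v\text{ and }u\curlywedge_{\mathcal P}v\},$$ let $D_{\mathcal P}^0(A)=A$, $D_{\mathcal P}^{\alpha+1}(A)=D_{\mathcal P}(D_{\mathcal P}^\alpha(A))$, $D_{\mathcal P}^\lambda(A)=\bigcap_{\beta<\lambda}D_{\mathcal P}^\beta(A)$ for limit ordinals $\lambda$, and let $|A|_{\mathcal P}$ be the least ordinal $\alpha$ with $D_{\mathcal P}^\alpha(A)=D_{\mathcal P}^{\alpha+1}(A)$. For $F\in F(X)$ let $A_F^{\mathcal P}=\{n\in\omega^2\mid B_{\mathcal P}(n)\cap F\neq\emptyset\}$ and $\phi_{\mathcal P}(F)=|A_F^{\mathcal P}|_{\mathcal P}$. Then $\phi_{\mathcal P}(F)<\omega_1$ for all $F\in F_{\aleph_0}(X)$, and $\phi_{\mathcal P}\colon F_{\aleph_0}(X)\to\omega_1$ is a co-analytic rank. That is, $F_{\aleph_0}(X)$ is a co-analytic subset of $F(X)$, and there are a co-analytic relation $R\subseteq F(X)\times F(X)$ and an analytic relation $S\subseteq F(X)\times F(X)$ such that for all $E\in F_{\aleph_0}(X)$ and all $F\in F(X)$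 $$(F,E)\in R\iff (F,E)\in S\iff \bigl(F\in F_{\aleph_0}(X)\text{ and }\phi_{\mathcal P}(F)\le\phi_{\mathcal P}(E)\bigr).$$ (A subset of a standard Borel space is analytic if it is analytic for a Polish topology generating the Borel structure, and co-analytic if its complement is analytic.) -/

import Mathlib

open Set TopologicalSpace

/-! ### Analytic and co-analytic sets in a standard Borel space -/

/-- A subset of a measurable space is analytic if it is analytic for some Polish topology
generating the given σ-algebra. In particular the ambient space is then standard Borel, and the
notion does not depend on the choice of the Polish topology. -/
def IsAnalytic {Y : Type*} [m : MeasurableSpace Y] (s : Set Y) : Prop :=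
  ∃ t : TopologicalSpace Y, @PolishSpace Y t ∧ @BorelSpace Y t m ∧
    @MeasureTheory.AnalyticSet Y t s

/-- A set is co-analytic if its complement is analytic. -/
def IsCoanalytic {Y : Type*} [MeasurableSpace Y] (s : Set Y) : Prop :=
  IsAnalytic sᶜ

theorem IsAnalytic.standardBorelSpace {Y : Type*} [MeasurableSpace Y] {s : Set Y}
    (hs : IsAnalytic s) : StandardBorelSpace Y := by
  obtain ⟨t, h1, h2, -⟩ := hs
  exact ⟨⟨t, h2, h1⟩⟩

/-- `φ` is a co-analytic rank on `A`: the set `A` is co-analytic, and there are a co-analytic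
relation `R` and an analytic relation `S` on the whole space such that for all `y ∈ A` and all `x`
one has `R x y ↔ S x y ↔ (x ∈ A and φ x ≤ φ y)`. Relations are subsets of the product space, which
carries the product σ-algebra. -/
def IsCoanalyticRank {Y : Type*} [MeasurableSpace Y] (A : Set Y) (φ : A → Ordinal.{0}) : Prop :=
  IsCoanalytic A ∧
    ∃ R S : Set (Y × Y), IsCoanalytic R ∧ IsAnalytic S ∧
      ∀ (y : A) (x : Y),
        ((x, (y : Y)) ∈ R ↔ ∃ hx : x ∈ A, φ ⟨x, hx⟩ ≤ φ y) ∧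
        ((x, (y : Y)) ∈ S ↔ ∃ hx : x ∈ A, φ ⟨x, hx⟩ ≤ φ y)

/-! ### The Effros Borel space -/

/-- The Effros Borel structure on the closed subsets of `X`: the σ-algebra generated by the sets
`{F | F ∩ U ≠ ∅}` for `U` open. -/
instance effrosMeasurableSpace (X : Type*) [TopologicalSpace X] : MeasurableSpace (Closeds X) :=
  MeasurableSpace.generateFrom
    {S | ∃ U : Set X, IsOpen U ∧ S = {F : Closeds X | ((F : Set X) ∩ U).Nonempty}}

/-- The set of countable (possibly finite or empty) closed subsets of `X`. -/
def countableClosed (X : Type*) [TopologicalSpace X] : Set (Closeds X) :=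
  {F | (F : Set X).Countable}

/-! ### Iterated derivatives -/

/-- The iterates of `D` at `A`: `D⁰ A = A`, `Dᵅ⁺¹ A = D (Dᵅ A)`, and intersections at limits. -/
noncomputable def iterDeriv {α : Type} (D : Set α → Set α) (A : Set α) (o : Ordinal.{0}) : Set α :=
  Ordinal.limitRecOn o A (fun _ B => D B) (fun l _ ih => ⋂ (b : Ordinal.{0}) (h : b < l), ih b h)

theorem iterDeriv_zero {α : Type} (D : Set α → Set α) (A : Set α) : iterDeriv D A 0 = A :=
  Ordinal.limitRecOn_zero ..

theorem iterDeriv_add_one {α : Type} (D : Set α → Set α) (A : Set α) (o : Ordinal.{0}) :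
    iterDeriv D A (o + 1) = D (iterDeriv D A o) :=
  Ordinal.limitRecOn_add_one ..

theorem iterDeriv_limit {α : Type} (D : Set α → Set α) (A : Set α) {o : Ordinal.{0}}
    (ho : Order.IsSuccLimit o) : iterDeriv D A o = ⋂ b < o, iterDeriv D A b :=
  Ordinal.limitRecOn_limit _ _ _ _ ho

theorem iterDeriv_antitone {α : Type} {D : Set α → Set α} (hD : ∀ B, D B ⊆ B) (A : Set α) :
    Antitone (iterDeriv D A) := by
  intro a b
  induction b using Ordinal.limitRecOn with
  | zero => intro h; rw [nonpos_iff_eq_zero.1 h]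
  | add_one b ih =>
    intro h
    rcases h.lt_or_eq with h | h
    · rw [iterDeriv_add_one]
      exact (hD _).trans (ih (Order.lt_add_one_iff.1 h))
    · rw [h]
  | limit b hb ih =>
    intro h
    rcases h.lt_or_eq with h | h
    · rw [iterDeriv_limit D A hb]
      exact iInter₂_subset a h
    · rw [h]

theorem exists_iterDeriv_eq {α : Type} {D : Set α → Set α} (hD : ∀ B, D B ⊆ B) (A : Set α) :
    ∃ o : Ordinal.{0}, iterDeriv D A o = iterDeriv D A (o + 1) := by
  have key : ∀ a b : Ordinal.{0}, a < b → iterDeriv D A a = iterDeriv D A b →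
      ∃ o : Ordinal.{0}, iterDeriv D A o = iterDeriv D A (o + 1) := fun a b hab h =>
    ⟨a, subset_antisymm (h.subset.trans (iterDeriv_antitone hD A (Order.add_one_le_of_lt hab)))
      (iterDeriv_antitone hD A (le_self_add))⟩
  have hni := not_injective_of_ordinal (iterDeriv D A)
  simp only [Function.Injective, not_forall] at hni
  obtain ⟨a, b, h, hne⟩ := hni
  rcases lt_or_gt_of_ne hne with hab | hab
  · exact key a b hab h
  · exact key b a hab h.symm

/-- The least `o` with `Dᵒ A = Dᵒ⁺¹ A` (it exists as soon as `D B ⊆ B` for all `B`). -/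
noncomputable def derivLength {α : Type} (D : Set α → Set α) (A : Set α) : Ordinal.{0} :=
  sInf {o | iterDeriv D A o = iterDeriv D A (o + 1)}

/-! ### Presentations of Polish spaces and the induced ranks -/

/-- A presentation of `X`: a complete metric inducing the topology of `X` and a dense sequence. -/
structure PolishPresentation (X : Type*) [t : TopologicalSpace X] where
  metric : MetricSpace X
  compatible : metric.toPseudoMetricSpace.toUniformSpace.toTopologicalSpace = t
  complete : @CompleteSpace X metric.toPseudoMetricSpace.toUniformSpace
  point : ℕ → X
  dense : DenseRange point

namespace PolishPresentation

/-- The metric of the presentation, as a function. -/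
def d {X : Type*} [TopologicalSpace X] (P : PolishPresentation X) (x y : X) : ℝ :=
  P.metric.dist x y

/-- The open ball with centre `x_{n(0)}` and radius `2^{-n(1)-1}`. -/
def ball {X : Type*} [TopologicalSpace X] (P : PolishPresentation X) (n : ℕ × ℕ) : Set X :=
  {x | P.d x (P.point n.1) < (1 / 2 : ℝ) ^ (n.2 + 1)}

/-- The closed ball with centre `x_{n(0)}` and radius `2^{-n(1)-1}`. -/
def closedBall {X : Type*} [TopologicalSpace X] (P : PolishPresentation X) (n : ℕ × ℕ) : Set X :=
  {x | P.d x (P.point n.1) ≤ (1 / 2 : ℝ) ^ (n.2 + 1)}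

/-- The relation `n ≺ m`. -/
def Prec {X : Type*} [TopologicalSpace X] (P : PolishPresentation X) (n m : ℕ × ℕ) : Prop :=
  n.2 < m.2 ∧ P.closedBall m ⊆ P.ball n

/-- The relation `n ⋏ m`: the closed balls are disjoint. -/
def Apart {X : Type*} [TopologicalSpace X] (P : PolishPresentation X) (n m : ℕ × ℕ) : Prop :=
  P.closedBall n ∩ P.closedBall m = ∅

/-- The derivative on subsets of `ω²`. -/
def deriv {X : Type*} [TopologicalSpace X] (P : PolishPresentation X) (A : Set (ℕ × ℕ)) :
    Set (ℕ × ℕ) :=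
  {n | n ∈ A ∧ ∃ u ∈ A, ∃ v ∈ A, P.Prec n u ∧ P.Prec n v ∧ P.Apart u v}

theorem deriv_subset {X : Type*} [TopologicalSpace X] (P : PolishPresentation X)
    (A : Set (ℕ × ℕ)) : P.deriv A ⊆ A :=
  fun _ h => h.1

/-- The set of (codes of) balls of the presentation that meet `F`. -/
def code {X : Type*} [TopologicalSpace X] (P : PolishPresentation X) (F : Closeds X) :
    Set (ℕ × ℕ) :=
  {n | (P.ball n ∩ (F : Set X)).Nonempty}

/-- The rank of a closed set: the length of the iterated derivative on the set of balls
meeting it. -/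
noncomputable def rank {X : Type*} [TopologicalSpace X] (P : PolishPresentation X)
    (F : Closeds X) : Ordinal.{0} :=
  derivLength P.deriv (P.code F)

/-- The length is attained, i.e. `rank` is really the least ordinal at which the iterated
derivative stabilizes. -/
theorem rank_spec {X : Type*} [TopologicalSpace X] (P : PolishPresentation X) (F : Closeds X) :
    iterDeriv P.deriv (P.code F) (P.rank F) =
      iterDeriv P.deriv (P.code F) (P.rank F + 1) :=
  csInf_mem (exists_iterDeriv_eq P.deriv_subset (P.code F))

end PolishPresentation

/-!
The derivative of the presentation is an instance of `splitDeriv T`: a point of a set survives if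
it is split, in the sense of a ternary relation `T`, by two points of the set. All ordinals are
eliminated from the comparison of lengths by means of simulations.

* A closed set `F` is countable if and only if no nonempty subset of its code is contained in its
  own derivative (`PolishPresentation.countable_iff_forall_subset_deriv`), i.e. if and only if the
  iteration at the code of `F` reaches `∅`. Hence, for an ordinal `o`, the set `F` is countable of
  rank at most `o` if and only if stage `o` of the iteration is empty
  (`PolishPresentation.exists_rank_le_iff`).
* Suppose that the iteration at `B` reaches `∅`. Whether the iteration at `A` has reached `∅` when
  the one at `B` does is equivalent to the existence of a relation which matches splittings in `A`
  with splittings in `B` (`exists_isSimulation_iff`), and its negation is equivalent to the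
  existence of a relation which does so strictly in the other direction
  (`exists_isStrictSimulation_iff`). Being such a relation is a Borel condition on the relation
  and on `A` and `B`, so both existence statements are analytic. This gives the two relations
  required of a co-analytic rank.
* Analyticity of subsets of the Effros Borel space includes that this space is standard Borel.
  Sending `F` to its code is a Borel isomorphism onto a Borel subset of the power set of `ℕ × ℕ`
  (`PolishPresentation.mem_range_code_iff`, `PolishPresentation.measurableEmbedding_code`), where
  completeness of the metric is what makes codes recognizable by a Borel condition.

The length of every iteration on a countable set is a countable ordinal since each stage removes a
point (`derivLength_lt_omega_one`).
-/

open Set TopologicalSpace Filter Topology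

/-! ### Iterated derivatives -/

section IteratedDerivatives

variable {α : Type} {D : Set α → Set α}

theorem iterDeriv_subset (hD : ∀ B, D B ⊆ B) (A : Set α) (o : Ordinal.{0}) :
    iterDeriv D A o ⊆ A := by
  simpa only [iterDeriv_zero] using iterDeriv_antitone hD A (zero_le : 0 ≤ o)

theorem iterDeriv_derivLength (hD : ∀ B, D B ⊆ B) (A : Set α) :
    iterDeriv D A (derivLength D A) = iterDeriv D A (derivLength D A + 1) :=
  csInf_mem (exists_iterDeriv_eq hD A)

/-- A set contained in its own derivative survives every stage of the iteration. -/
theorem subset_iterDeriv_of_subset_deriv (hmono : Monotone D) {A C : Set α} (hCA : C ⊆ A)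
    (hC : C ⊆ D C) (o : Ordinal.{0}) : C ⊆ iterDeriv D A o := by
  induction o using Ordinal.limitRecOn with
  | zero => rwa [iterDeriv_zero]
  | add_one b ih => rw [iterDeriv_add_one]; exact hC.trans (hmono ih)
  | limit b hb ih => rw [iterDeriv_limit D A hb]; exact subset_iInter₂ ih

theorem derivLength_le_of_iterDeriv_eq_empty (hD : ∀ B, D B ⊆ B) {A : Set α} {o : Ordinal.{0}}
    (h : iterDeriv D A o = ∅) : derivLength D A ≤ o := by
  refine csInf_le' ?_
  have := iterDeriv_antitone hD A (le_self_add : o ≤ o + 1)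
  rw [h, subset_empty_iff] at this
  rw [mem_ofPred_eq, h, this]

theorem nonempty_iterDeriv_of_lt (hD : ∀ B, D B ⊆ B) {A : Set α} {o : Ordinal.{0}}
    (h : o < derivLength D A) : (iterDeriv D A o).Nonempty := by
  by_contra hne
  exact (derivLength_le_of_iterDeriv_eq_empty hD (not_nonempty_iff_eq_empty.1 hne)).not_gt h

/-- The iteration reaches `∅` if and only if no nonempty subset is contained in its own
derivative. -/
theorem iterDeriv_derivLength_eq_empty_iff (hD : ∀ B, D B ⊆ B) (hmono : Monotone D) {A : Set α} :
    iterDeriv D A (derivLength D A) = ∅ ↔ ∀ C ⊆ A, C ⊆ D C → C = ∅ := by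
  constructor
  · intro h C hCA hC
    exact subset_empty_iff.1 (h ▸ subset_iterDeriv_of_subset_deriv hmono hCA hC _)
  · intro h
    refine h _ (iterDeriv_subset hD A _) ?_
    rw [← iterDeriv_add_one D]
    exact (iterDeriv_derivLength hD A).subset

theorem iterDeriv_eq_empty_iff (hD : ∀ B, D B ⊆ B) (hmono : Monotone D) {A : Set α}
    {o : Ordinal.{0}} :
    iterDeriv D A o = ∅ ↔ iterDeriv D A (derivLength D A) = ∅ ∧ derivLength D A ≤ o := by
  constructor
  · intro h
    refine ⟨?_, derivLength_le_of_iterDeriv_eq_empty hD h⟩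
    rw [iterDeriv_derivLength_eq_empty_iff hD hmono]
    intro C hCA hC
    exact subset_empty_iff.1 (h ▸ subset_iterDeriv_of_subset_deriv hmono hCA hC _)
  · rintro ⟨h, hle⟩
    exact subset_empty_iff.1 (h ▸ iterDeriv_antitone hD A hle)

/-- A subset which is not contained in stage `o` leaves the iteration at a successor stage. -/
theorem exists_subset_iterDeriv_not_subset {A s : Set α} (hs : s ⊆ A) {o : Ordinal.{0}}
    (ho : ¬ s ⊆ iterDeriv D A o) :
    ∃ b < o, s ⊆ iterDeriv D A b ∧ ¬ s ⊆ iterDeriv D A (b + 1) := by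
  induction o using Ordinal.limitRecOn with
  | zero => rw [iterDeriv_zero] at ho; exact absurd hs ho
  | add_one b ih =>
    by_cases h : s ⊆ iterDeriv D A b
    · exact ⟨b, Order.lt_add_one_iff.2 le_rfl, h, ho⟩
    · obtain ⟨c, hc, h'⟩ := ih h
      exact ⟨c, hc.trans (Order.lt_add_one_iff.2 le_rfl), h'⟩
  | limit b hb ih =>
    rw [iterDeriv_limit D A hb, subset_iInter₂_iff] at ho
    push Not at ho
    obtain ⟨c, hc, h⟩ := ho
    obtain ⟨e, he, h'⟩ := ih c hc h
    exact ⟨e, he.trans hc, h'⟩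

/-- On a countable type the iteration stabilizes at a countable stage: each stage before the
length removes a point, and different stages remove different points. -/
theorem derivLength_lt_omega_one [Countable α] (hD : ∀ B, D B ⊆ B) (A : Set α) :
    derivLength D A < Ordinal.omega 1 := by
  have h : ∀ b : Iio (derivLength D A),
      ∃ x, x ∈ iterDeriv D A b ∧ x ∉ iterDeriv D A ((b : Ordinal.{0}) + 1) := by
    rintro ⟨b, hb⟩
    by_contra! hne
    have heq : iterDeriv D A b = iterDeriv D A (b + 1) :=
      subset_antisymm hne (iterDeriv_antitone hD A le_self_add)
    exact (csInf_le' (mem_ofPred.2 heq) : derivLength D A ≤ b).not_gt hb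
  choose f hf hf' using h
  have key : ∀ b c, b < c → f b ≠ f c := fun b c hbc hfe =>
    hf' b (hfe ▸ iterDeriv_antitone hD A (Order.add_one_le_of_lt (Subtype.coe_lt_coe.2 hbc)) (hf c))
  have hinj : Function.Injective f := by
    intro b c hbc
    by_contra hne
    rcases lt_or_gt_of_ne hne with h | h
    · exact key b c h hbc
    · exact key c b h hbc.symm
  have hc : Countable (Iio (derivLength D A)) := hinj.countable
  rw [Cardinal.lt_omega_iff_card_lt]
  have h1 := Cardinal.mk_le_aleph0_iff.2 hc
  rw [Cardinal.mk_Iio_ordinal, Cardinal.lift_le_aleph0] at h1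
  exact h1.trans_lt Cardinal.aleph0_lt_aleph_one

end IteratedDerivatives

/-! ### Comparing lengths by simulations -/

section Simulations

variable {α : Type}

/-- The derivative attached to a ternary relation `T`, where `T n u v` is read as "`u` and `v`
split `n`": it keeps the points of `A` that are split by two points of `A`. -/
def splitDeriv (T : α → α → α → Prop) (A : Set α) : Set α :=
  {n | n ∈ A ∧ ∃ u ∈ A, ∃ v ∈ A, T n u v}

variable {T : α → α → α → Prop} {A B : Set α}

theorem splitDeriv_subset (T : α → α → α → Prop) (A : Set α) : splitDeriv T A ⊆ A :=
  fun _ h => h.1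

theorem splitDeriv_mono (T : α → α → α → Prop) : Monotone (splitDeriv T) :=
  fun _ _ h _ ⟨hn, u, hu, v, hv, hT⟩ => ⟨h hn, u, h hu, v, h hv, hT⟩

theorem mem_iterDeriv_add_one_of_split {n u v : α} {o : Ordinal.{0}} (hn : n ∈ A)
    (hu : u ∈ iterDeriv (splitDeriv T) A o) (hv : v ∈ iterDeriv (splitDeriv T) A o)
    (hT : T n u v) : n ∈ iterDeriv (splitDeriv T) A (o + 1) := by
  have hanti := iterDeriv_antitone (splitDeriv_subset T) A
  have key : ∀ b ≤ o, n ∈ iterDeriv (splitDeriv T) A b := by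
    intro b
    induction b using Ordinal.limitRecOn with
    | zero => intro _; rwa [iterDeriv_zero]
    | add_one b ih =>
      intro hb
      have hb' : b ≤ o := le_self_add.trans hb
      rw [iterDeriv_add_one]
      exact ⟨ih hb', u, hanti hb' hu, v, hanti hb' hv, hT⟩
    | limit b hb ih =>
      intro hbo
      rw [iterDeriv_limit _ _ hb]
      exact mem_iInter₂.2 fun c hc => ih c hc (hc.le.trans hbo)
  rw [iterDeriv_add_one]
  exact ⟨key o le_rfl, u, hu, v, hv, hT⟩

/-- `Z` is a simulation from `A` to `B`, the pair `(n, m)` being in `Z` is meant to witness that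
`m` survives in `B` at least as long as `n` does in `A`: every splitting of `n` in `A` is answered
by a splitting of `m` in `B`, each member of which dominates some member of the former. -/
def IsSimulation (T : α → α → α → Prop) (A B : Set α) (Z : Set (α × α)) : Prop :=
  ∀ n m, (n, m) ∈ Z → m ∈ B ∧ ∀ u v, u ∈ A ∧ v ∈ A ∧ T n u v →
    ∃ u' v', u' ∈ B ∧ v' ∈ B ∧ T m u' v' ∧
      ((u, u') ∈ Z ∨ (v, u') ∈ Z) ∧ ((u, v') ∈ Z ∨ (v, v') ∈ Z)

/-- `W` is a strict simulation from `B` to `A`, the pair `(m, n)` being in `W` is meant to witness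
that `n` survives in `A` strictly longer than `m` does in `B`: some splitting of `n` in `A` has
both members strictly dominating some member of each splitting of `m` in `B`. -/
def IsStrictSimulation (T : α → α → α → Prop) (B A : Set α) (W : Set (α × α)) : Prop :=
  ∀ m n, (m, n) ∈ W → n ∈ A ∧ ∃ u v, u ∈ A ∧ v ∈ A ∧ T n u v ∧
    ∀ u' v', u' ∈ B ∧ v' ∈ B ∧ T m u' v' →
      ((u', u) ∈ W ∨ (v', u) ∈ W) ∧ ((u', v) ∈ W ∨ (v', v) ∈ W)

theorem IsSimulation.mem_iterDeriv {Z : Set (α × α)} (hZ : IsSimulation T A B Z)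
    (o : Ordinal.{0}) : ∀ n m, (n, m) ∈ Z → n ∈ iterDeriv (splitDeriv T) A o →
      m ∈ iterDeriv (splitDeriv T) B o := by
  induction o using Ordinal.limitRecOn with
  | zero => intro n m h _; rw [iterDeriv_zero]; exact (hZ n m h).1
  | add_one b ih =>
    intro n m h hn
    rw [iterDeriv_add_one] at hn
    obtain ⟨-, u, hu, v, hv, hT⟩ := hn
    obtain ⟨u', v', -, -, hT', hu', hv'⟩ := (hZ n m h).2 u v
      ⟨iterDeriv_subset (splitDeriv_subset T) A b hu,
        iterDeriv_subset (splitDeriv_subset T) A b hv, hT⟩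
    exact mem_iterDeriv_add_one_of_split (hZ n m h).1
      (hu'.elim (fun h => ih _ _ h hu) (fun h => ih _ _ h hv))
      (hv'.elim (fun h => ih _ _ h hu) (fun h => ih _ _ h hv)) hT'
  | limit b hb ih =>
    intro n m h hn
    rw [iterDeriv_limit _ _ hb] at hn ⊢
    exact mem_iInter₂.2 fun c hc => ih c hc n m h (mem_iInter₂.1 hn c hc)

theorem IsStrictSimulation.mem_iterDeriv {W : Set (α × α)} (hW : IsStrictSimulation T B A W)
    (o : Ordinal.{0}) : ∀ m n, (m, n) ∈ W → m ∈ iterDeriv (splitDeriv T) B o →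
      n ∈ iterDeriv (splitDeriv T) A (o + 1) := by
  induction o using Ordinal.limitRecOn with
  | zero =>
    intro m n h _
    obtain ⟨hn, u, v, hu, hv, hT, -⟩ := hW m n h
    rw [iterDeriv_add_one, iterDeriv_zero]
    exact ⟨hn, u, hu, v, hv, hT⟩
  | add_one b ih =>
    intro m n h hm
    obtain ⟨hn, u, v, hu, hv, hT, hs⟩ := hW m n h
    rw [iterDeriv_add_one] at hm
    obtain ⟨-, u', hu', v', hv', hT'⟩ := hm
    obtain ⟨h1, h2⟩ := hs u' v' ⟨iterDeriv_subset (splitDeriv_subset T) B b hu',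
      iterDeriv_subset (splitDeriv_subset T) B b hv', hT'⟩
    exact mem_iterDeriv_add_one_of_split hn
      (h1.elim (fun h => ih _ _ h hu') (fun h => ih _ _ h hv'))
      (h2.elim (fun h => ih _ _ h hu') (fun h => ih _ _ h hv')) hT
  | limit b hb ih =>
    intro m n h hm
    obtain ⟨hn, u, v, hu, hv, hT, hs⟩ := hW m n h
    rw [iterDeriv_limit _ _ hb] at hm
    -- For each `c < b` the point `m` is still split at stage `c`, as it lies in stage `c + 1`.
    have key : ∀ c < b, u ∈ iterDeriv (splitDeriv T) A c ∧ v ∈ iterDeriv (splitDeriv T) A c := by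
      intro c hc
      have hm' := mem_iInter₂.1 hm (c + 1) (hb.add_one_lt hc)
      rw [iterDeriv_add_one] at hm'
      obtain ⟨-, u', hu', v', hv', hT'⟩ := hm'
      obtain ⟨h1, h2⟩ := hs u' v' ⟨iterDeriv_subset (splitDeriv_subset T) B c hu',
        iterDeriv_subset (splitDeriv_subset T) B c hv', hT'⟩
      have hanti := iterDeriv_antitone (splitDeriv_subset T) A (le_self_add : c ≤ c + 1)
      exact ⟨hanti (h1.elim (fun h => ih c hc _ _ h hu') (fun h => ih c hc _ _ h hv')),
        hanti (h2.elim (fun h => ih c hc _ _ h hu') (fun h => ih c hc _ _ h hv'))⟩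
    refine mem_iterDeriv_add_one_of_split hn ?_ ?_ hT
    · rw [iterDeriv_limit _ _ hb]; exact mem_iInter₂.2 fun c hc => (key c hc).1
    · rw [iterDeriv_limit _ _ hb]; exact mem_iInter₂.2 fun c hc => (key c hc).2

/-- If the iteration at `B` ends in `∅`, then the iteration at `A` reaches `∅` no later than the
one at `B` if and only if some simulation from `A` to `B` is total on `A`. -/
theorem exists_isSimulation_iff
    (hB : iterDeriv (splitDeriv T) B (derivLength (splitDeriv T) B) = ∅) :
    (∃ Z, IsSimulation T A B Z ∧ ∀ n, n ∈ A → ∃ m, (n, m) ∈ Z) ↔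
      iterDeriv (splitDeriv T) A (derivLength (splitDeriv T) B) = ∅ := by
  have hantiA := iterDeriv_antitone (splitDeriv_subset T) A
  have hantiB := iterDeriv_antitone (splitDeriv_subset T) B
  constructor
  · rintro ⟨Z, hZ, htot⟩
    refine eq_empty_of_forall_notMem fun n hn => ?_
    obtain ⟨m, hm⟩ := htot n (iterDeriv_subset (splitDeriv_subset T) A _ hn)
    have := hZ.mem_iterDeriv _ n m hm hn
    rw [hB] at this
    exact this
  · intro hA
    refine ⟨{p | p.1 ∈ A ∧ p.2 ∈ B ∧ ∀ o, p.1 ∈ iterDeriv (splitDeriv T) A o →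
      p.2 ∈ iterDeriv (splitDeriv T) B o}, ?_, ?_⟩
    · rintro n m ⟨hn, hm, hnm⟩
      refine ⟨hm, ?_⟩
      rintro u v ⟨hu, hv, hT⟩
      have huv : ¬ ({u, v} : Set α) ⊆
          iterDeriv (splitDeriv T) A (derivLength (splitDeriv T) B) := by
        rw [hA]; exact fun h => h (mem_insert _ _)
      obtain ⟨b, -, hb, hb'⟩ :=
        exists_subset_iterDeriv_not_subset (pair_subset hu hv) huv
      have hmb := hnm _ (mem_iterDeriv_add_one_of_split hn (hb (by simp)) (hb (by simp)) hT)
      rw [iterDeriv_add_one] at hmb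
      obtain ⟨-, u', hu', v', hv', hT'⟩ := hmb
      have hu'B := iterDeriv_subset (splitDeriv_subset T) B b hu'
      have hv'B := iterDeriv_subset (splitDeriv_subset T) B b hv'
      -- A point that leaves `A` at stage `b` is dominated by every point in stage `b` of `B`.
      have key : ∀ w ∈ A, w ∉ iterDeriv (splitDeriv T) A (b + 1) →
          ∀ w' ∈ iterDeriv (splitDeriv T) B b, ∀ o, w ∈ iterDeriv (splitDeriv T) A o →
            w' ∈ iterDeriv (splitDeriv T) B o := by
        intro w _ hw w' hw' o ho
        refine hantiB ?_ hw'
        by_contra! hlt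
        exact hw (hantiA (Order.add_one_le_of_lt hlt) ho)
      refine ⟨u', v', hu'B, hv'B, hT', ?_⟩
      rw [pair_subset_iff, not_and_or] at hb'
      rcases hb' with h | h
      · exact ⟨.inl ⟨hu, hu'B, key u hu h u' hu'⟩, .inl ⟨hu, hv'B, key u hu h v' hv'⟩⟩
      · exact ⟨.inr ⟨hv, hu'B, key v hv h u' hu'⟩, .inr ⟨hv, hv'B, key v hv h v' hv'⟩⟩
    · intro n hn
      have hn' : ¬ ({n} : Set α) ⊆
          iterDeriv (splitDeriv T) A (derivLength (splitDeriv T) B) := by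
        rw [hA]; exact fun h => h rfl
      obtain ⟨b, hb, -, hnb⟩ :=
        exists_subset_iterDeriv_not_subset (singleton_subset_iff.2 hn) hn'
      obtain ⟨m, hm⟩ := nonempty_iterDeriv_of_lt (splitDeriv_subset T) hb
      refine ⟨m, hn, iterDeriv_subset (splitDeriv_subset T) B b hm, fun o ho => hantiB ?_ hm⟩
      by_contra! hlt
      exact hnb (singleton_subset_iff.2 (hantiA (Order.add_one_le_of_lt hlt) ho))

/-- If the iteration at `B` ends in `∅`, then the iteration at `A` is still nonempty when the one
at `B` ends if and only if some point of `A` strictly dominates all points of `B` in a strict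
simulation. -/
theorem exists_isStrictSimulation_iff
    (hB : iterDeriv (splitDeriv T) B (derivLength (splitDeriv T) B) = ∅) :
    (∃ W, IsStrictSimulation T B A W ∧ ∃ n, n ∈ A ∧ ∀ m, m ∈ B → (m, n) ∈ W) ↔
      (iterDeriv (splitDeriv T) A (derivLength (splitDeriv T) B)).Nonempty := by
  have hantiA := iterDeriv_antitone (splitDeriv_subset T) A
  have hantiB := iterDeriv_antitone (splitDeriv_subset T) B
  constructor
  · rintro ⟨W, hW, n, hn, hmn⟩
    refine ⟨n, ?_⟩
    by_contra hnot
    obtain ⟨b, hb, -, hnb⟩ := exists_subset_iterDeriv_not_subset (D := splitDeriv T)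
      (singleton_subset_iff.2 hn) (fun h => hnot (singleton_subset_iff.1 h))
    obtain ⟨m, hm⟩ := nonempty_iterDeriv_of_lt (splitDeriv_subset T) hb
    exact hnb (singleton_subset_iff.2 (hW.mem_iterDeriv b m n
      (hmn m (iterDeriv_subset (splitDeriv_subset T) B b hm)) hm))
  · rintro ⟨n, hn⟩
    refine ⟨{p | p.1 ∈ B ∧ p.2 ∈ A ∧ ∀ o, p.1 ∈ iterDeriv (splitDeriv T) B o →
      p.2 ∈ iterDeriv (splitDeriv T) A (o + 1)}, ?_, n,
      iterDeriv_subset (splitDeriv_subset T) A _ hn, ?_⟩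
    · rintro m n ⟨hm, hn, hmn⟩
      refine ⟨hn, ?_⟩
      obtain ⟨b, -, hb, hb'⟩ := exists_subset_iterDeriv_not_subset (D := splitDeriv T)
        (singleton_subset_iff.2 hm) (o := derivLength (splitDeriv T) B)
        (by rw [hB]; exact fun h => h rfl)
      rw [singleton_subset_iff] at hb hb'
      have hnb := hmn b hb
      rw [iterDeriv_add_one] at hnb
      obtain ⟨-, u, hu, v, hv, hT⟩ := hnb
      have huA := iterDeriv_subset (splitDeriv_subset T) A b hu
      have hvA := iterDeriv_subset (splitDeriv_subset T) A b hv
      refine ⟨u, v, huA, hvA, hT, ?_⟩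
      rintro u' v' ⟨hu', hv', hT'⟩
      -- A point missing from stage `b` of `B` is strictly dominated by every point in stage `b`
      -- of `A`.
      have key : ∀ w' ∉ iterDeriv (splitDeriv T) B b, ∀ w ∈ iterDeriv (splitDeriv T) A b,
          ∀ o, w' ∈ iterDeriv (splitDeriv T) B o → w ∈ iterDeriv (splitDeriv T) A (o + 1) := by
        intro w' hw' w hw o ho
        refine hantiA (Order.add_one_le_of_lt ?_) hw
        by_contra! hle
        exact hw' (hantiB hle ho)
      by_cases h : u' ∈ iterDeriv (splitDeriv T) B b
      · have h' : v' ∉ iterDeriv (splitDeriv T) B b := fun h' =>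
          hb' (mem_iterDeriv_add_one_of_split hm h h' hT')
        exact ⟨.inr ⟨hv', huA, key v' h' u hu⟩, .inr ⟨hv', hvA, key v' h' v hv⟩⟩
      · exact ⟨.inl ⟨hu', huA, key u' h u hu⟩, .inl ⟨hu', hvA, key u' h v hv⟩⟩
    · intro m hm
      refine ⟨hm, iterDeriv_subset (splitDeriv_subset T) A _ hn, fun o ho => hantiA ?_ hn⟩
      refine Order.add_one_le_of_lt ?_
      by_contra! hle
      have := hantiB hle ho
      rw [hB] at this
      exact this

end Simulations

/-! ### Standard Borel spaces and projections -/

theorem MeasurableEmbedding.standardBorelSpace {Y Z : Type*} [MeasurableSpace Y]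
    [MeasurableSpace Z] [StandardBorelSpace Z] {f : Y → Z} (hf : MeasurableEmbedding f) :
    StandardBorelSpace Y := by
  obtain ⟨τ, hB, hP⟩ := hf.measurableSet_range.standardBorel.polish
  let σ : TopologicalSpace Y := τ.induced hf.equivRange
  refine ⟨⟨σ, ⟨?_⟩, hf.equivRange.toEquiv.polishSpace_induced⟩⟩
  rw [borel_comap, ← hB.measurable_eq]
  exact hf.equivRange.measurableEmbedding.comap_eq.symm

instance Set.standardBorelSpace {α : Type*} [Countable α] : StandardBorelSpace (Set α) :=
  inferInstanceAs (StandardBorelSpace (α → Prop))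

/-- The projection of a Borel set along a standard Borel space is analytic. -/
theorem isAnalytic_setOf_exists {Y Z : Type*} [MeasurableSpace Y] [StandardBorelSpace Y]
    [MeasurableSpace Z] [StandardBorelSpace Z] {p : Y → Z → Prop}
    (hp : Measurable fun q : Y × Z => p q.1 q.2) : IsAnalytic {y | ∃ z, p y z} := by
  let := upgradeStandardBorel Y
  refine ⟨inferInstance, inferInstance, inferInstance, ?_⟩
  have : {y | ∃ z, p y z} = Prod.fst '' {q : Y × Z | p q.1 q.2} := by
    ext y
    simp
  rw [this]
  exact (measurableSet_setOfPred.2 hp).analyticSet_image measurable_fst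

/-! ### Balls of a presentation -/

namespace PolishPresentation

variable {X : Type*} [TopologicalSpace X] (P : PolishPresentation X)

theorem isOpen_ball (n : ℕ × ℕ) : IsOpen (P.ball n) := by
  obtain ⟨M, rfl, hc, p, hp⟩ := P
  exact Metric.isOpen_ball (x := p n.1) (ε := (1 / 2 : ℝ) ^ (n.2 + 1))

include P in
theorem t2Space : T2Space X := by
  obtain ⟨M, rfl, hc, p, hp⟩ := P
  infer_instance

theorem ball_subset_closedBall (n : ℕ × ℕ) : P.ball n ⊆ P.closedBall n :=
  fun _ h => le_of_lt (mem_ofPred.1 h)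

theorem Prec.ball_subset {P : PolishPresentation X} {n m : ℕ × ℕ} (h : P.Prec n m) :
    P.ball m ⊆ P.ball n :=
  (P.ball_subset_closedBall m).trans h.2

/-- Every neighbourhood of `x` contains closed balls of the presentation that have arbitrarily
small radius and whose open balls contain `x`. -/
theorem exists_ball {U : Set X} (hU : IsOpen U) {x : X} (hx : x ∈ U) (k : ℕ) :
    ∃ m : ℕ × ℕ, k < m.2 ∧ x ∈ P.ball m ∧ P.closedBall m ⊆ U := by
  obtain ⟨M, rfl, hc, p, hp⟩ := P
  obtain ⟨ε, hε, hεU⟩ := Metric.isOpen_iff.1 hU x hx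
  obtain ⟨N, hN⟩ := exists_pow_lt_of_lt_one hε (by norm_num : (1 / 2 : ℝ) < 1)
  set j := max N (k + 1)
  have hpos : (0 : ℝ) < (1 / 2) ^ (j + 1) := by positivity
  obtain ⟨i, hi⟩ := hp.exists_dist_lt x hpos
  refine ⟨(i, j), lt_of_lt_of_le (Nat.lt_succ_self k) (le_max_right _ _), hi, fun y hy => hεU ?_⟩
  have hy' : dist y (p i) ≤ (1 / 2 : ℝ) ^ (j + 1) := hy
  have h1 : (1 / 2 : ℝ) ^ j ≤ (1 / 2) ^ N :=
    pow_le_pow_of_le_one (by norm_num) (by norm_num) (le_max_left _ _)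
  have h2 := dist_triangle_right y x (p i)
  rw [pow_succ] at hy' hi
  rw [Metric.mem_ball]
  linarith

theorem exists_prec {n : ℕ × ℕ} {U : Set X} (hU : IsOpen U) {x : X} (hx : x ∈ U)
    (hxn : x ∈ P.ball n) : ∃ m, P.Prec n m ∧ x ∈ P.ball m ∧ P.closedBall m ⊆ U := by
  obtain ⟨m, hm, hxm, hsub⟩ := P.exists_ball ((P.isOpen_ball n).inter hU) ⟨hxn, hx⟩ n.2
  exact ⟨m, ⟨hm, hsub.trans inter_subset_left⟩, hxm, hsub.trans inter_subset_right⟩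

/-- By completeness, points chosen in the balls of a `≺`-increasing sequence converge to a point
common to all these balls, and the balls form a neighbourhood basis of this point. -/
theorem exists_tendsto_of_prec {n : ℕ → ℕ × ℕ} (hn : ∀ k, P.Prec (n k) (n (k + 1))) {y : ℕ → X}
    (hy : ∀ k, y k ∈ P.ball (n k)) :
    ∃ x, Tendsto y atTop (𝓝 x) ∧ (∀ k, x ∈ P.ball (n k)) ∧
      ∀ U, IsOpen U → x ∈ U → ∃ k, P.ball (n k) ⊆ U := by
  have hanti : Antitone fun k => P.ball (n k) := antitone_nat_of_succ_le fun k => (hn k).ball_subset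
  have hrad : ∀ k, k ≤ (n k).2 := by
    intro k
    induction k with
    | zero => exact Nat.zero_le _
    | succ k ih => exact Nat.succ_le_of_lt (ih.trans_lt (hn k).1)
  obtain ⟨M, rfl, hc, p, hp⟩ := P
  set P : @PolishPresentation X M.toPseudoMetricSpace.toUniformSpace.toTopologicalSpace :=
    ⟨M, rfl, hc, p, hp⟩
  have hball : ∀ k x, x ∈ P.ball (n k) → dist x (p (n k).1) < (1 / 2 : ℝ) ^ (k + 1) := by
    intro k x hx
    exact lt_of_lt_of_le hx
      (pow_le_pow_of_le_one (by norm_num) (by norm_num) (Nat.succ_le_succ (hrad k)))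
  have hdist : ∀ k x z, x ∈ P.ball (n k) → z ∈ P.ball (n k) → dist x z < (1 / 2 : ℝ) ^ k := by
    intro k x z hx hz
    have h1 := hball k x hx
    have h2 := hball k z hz
    have h3 := dist_triangle_right x z (p (n k).1)
    rw [pow_succ] at h1 h2
    linarith
  have htend : Tendsto (fun k : ℕ => (1 / 2 : ℝ) ^ k) atTop (𝓝 0) :=
    tendsto_pow_atTop_nhds_zero_of_lt_one (by norm_num) (by norm_num)
  have hcauchy : CauchySeq y := by
    refine cauchySeq_of_le_tendsto_0 (fun k => (1 / 2 : ℝ) ^ k) (fun i j N hi hj => ?_) htend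
    exact (hdist N _ _ (hanti hi (hy i)) (hanti hj (hy j))).le
  obtain ⟨x, hx⟩ := cauchySeq_tendsto_of_complete hcauchy
  have hmem : ∀ k, x ∈ P.ball (n k) := by
    intro k
    refine (hn k).2 ?_
    refine (Metric.isClosed_closedBall (x := p (n (k + 1)).1)
      (ε := (1 / 2 : ℝ) ^ ((n (k + 1)).2 + 1))).mem_of_tendsto hx ?_
    filter_upwards [eventually_ge_atTop (k + 1)] with i hi
    exact P.ball_subset_closedBall _ (hanti hi (hy i))
  refine ⟨x, hx, hmem, fun U hU hxU => ?_⟩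
  obtain ⟨ε, hε, hεU⟩ := Metric.isOpen_iff.1 hU x hxU
  obtain ⟨k, hk⟩ := (htend.eventually_lt_const hε).exists
  exact ⟨k, fun z hz => hεU ((hdist k z x hz (hmem k)).trans hk)⟩

/-! ### Codes of closed sets and the Effros Borel space -/

theorem mem_iff_forall_mem_code (F : Closeds X) (x : X) :
    x ∈ F ↔ ∀ n, x ∈ P.ball n → n ∈ P.code F := by
  refine ⟨fun hx n hn => ⟨x, hn, hx⟩, fun h => ?_⟩
  by_contra hx
  obtain ⟨m, -, hxm, hm⟩ := P.exists_ball F.isClosed.isOpen_compl hx 0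
  obtain ⟨y, hy, hyF⟩ := h m hxm
  exact hm (P.ball_subset_closedBall m hy) hyF

theorem code_injective : Function.Injective P.code := by
  intro F G h
  ext x
  rw [SetLike.mem_coe, SetLike.mem_coe, P.mem_iff_forall_mem_code, h, ← P.mem_iff_forall_mem_code]

theorem inter_nonempty_iff_exists_mem_code (F : Closeds X) {U : Set X} (hU : IsOpen U) :
    ((F : Set X) ∩ U).Nonempty ↔ ∃ n, P.ball n ⊆ U ∧ n ∈ P.code F := by
  constructor
  · rintro ⟨x, hxF, hxU⟩
    obtain ⟨m, -, hxm, hm⟩ := P.exists_ball hU hxU 0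
    exact ⟨m, (P.ball_subset_closedBall m).trans hm, x, hxm, hxF⟩
  · rintro ⟨n, hn, x, hxn, hxF⟩
    exact ⟨x, hxF, hn hxn⟩

/-- A set of balls is the code of a closed set if and only if it is closed under passing to larger
balls and each of its members has a `≺`-successor in it. For the converse, the closed set is that
of the points all of whose balls belong to the set. -/
theorem mem_range_code_iff (A : Set (ℕ × ℕ)) :
    A ∈ range P.code ↔
      (∀ n, n ∈ A → ∃ m, P.Prec n m ∧ m ∈ A) ∧ ∀ n m, P.ball n ⊆ P.ball m → n ∈ A → m ∈ A := by
  constructor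
  · rintro ⟨F, rfl⟩
    refine ⟨?_, fun n m h hn => hn.mono (inter_subset_inter_left _ h)⟩
    rintro n ⟨x, hxn, hxF⟩
    obtain ⟨m, hm, hxm, -⟩ := P.exists_prec isOpen_univ (mem_univ x) hxn
    exact ⟨m, hm, x, hxm, hxF⟩
  · rintro ⟨hsucc, hup⟩
    have hclosed : IsClosed {x | ∀ n, x ∈ P.ball n → n ∈ A} := by
      have : {x | ∀ n, x ∈ P.ball n → n ∈ A} = ⋂ (n) (_ : n ∉ A), (P.ball n)ᶜ := by
        ext x
        simp only [mem_ofPred_eq, mem_iInter, mem_compl_iff]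
        exact forall_congr' fun n => not_imp_not.symm
      rw [this]
      exact isClosed_iInter fun n => isClosed_iInter fun _ => (P.isOpen_ball n).isClosed_compl
    refine ⟨⟨_, hclosed⟩, Set.ext fun n => ⟨fun ⟨x, hxn, hx⟩ => hx n hxn, fun hn => ?_⟩⟩
    choose! f hf hfA using hsucc
    have hA : ∀ k, f^[k] n ∈ A := by
      intro k
      induction k with
      | zero => exact hn
      | succ k ih => rw [Function.iterate_succ_apply']; exact hfA _ ih
    have hprec : ∀ k, P.Prec (f^[k] n) (f^[k + 1] n) := fun k => by
      rw [Function.iterate_succ_apply']; exact hf _ (hA k)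
    have hpt : ∀ m : ℕ × ℕ, P.point m.1 ∈ P.ball m := by
      intro m
      change P.metric.dist _ _ < _
      rw [P.metric.dist_self]
      positivity
    obtain ⟨x, -, hx, hbasis⟩ := P.exists_tendsto_of_prec hprec fun k => hpt (f^[k] n)
    refine ⟨x, hx 0, fun m hm => ?_⟩
    obtain ⟨k, hk⟩ := hbasis _ (P.isOpen_ball m) hm
    exact hup _ _ hk (hA k)

@[fun_prop]
theorem measurable_code : Measurable P.code := by
  rw [measurable_set_iff]
  intro n
  refine measurableSet_setOfPred.1 (MeasurableSpace.measurableSet_generateFrom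
    ⟨P.ball n, P.isOpen_ball n, ?_⟩)
  ext F
  rw [mem_ofPred_eq, mem_ofPred_eq, inter_comm]
  rfl

theorem measurableSet_range_code : MeasurableSet (range P.code) := by
  have : range P.code = {A | (∀ n, n ∈ A → ∃ m, P.Prec n m ∧ m ∈ A) ∧
      ∀ n m, P.ball n ⊆ P.ball m → n ∈ A → m ∈ A} := Set.ext P.mem_range_code_iff
  rw [this, measurableSet_setOfPred]
  fun_prop

theorem measurableEmbedding_code : MeasurableEmbedding P.code where
  injective := P.code_injective
  measurable := P.measurable_code
  measurableSet_image' := by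
    have hle : effrosMeasurableSpace X ≤ MeasurableSpace.comap P.code inferInstance := by
      refine MeasurableSpace.generateFrom_le ?_
      rintro _ ⟨U, hU, rfl⟩
      refine ⟨{A | ∃ n, P.ball n ⊆ U ∧ n ∈ A}, measurableSet_setOfPred.2 (by fun_prop), ?_⟩
      ext F
      exact (P.inter_nonempty_iff_exists_mem_code F hU).symm
    intro S hS
    obtain ⟨T, hT, rfl⟩ := hle S hS
    rw [image_preimage_eq_inter_range]
    exact hT.inter P.measurableSet_range_code

include P in
/-- The Effros Borel space of closed subsets of a Polish space is standard Borel: it is isomorphic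
to the Borel set of codes. -/
theorem standardBorelSpace_closeds : StandardBorelSpace (Closeds X) :=
  P.measurableEmbedding_code.standardBorelSpace

/-! ### Countable closed sets -/

/-- The relation "`u` and `v` are apart and both succeed `n`", which gives the derivative of the
presentation. -/
def Split (n u v : ℕ × ℕ) : Prop := P.Prec n u ∧ P.Prec n v ∧ P.Apart u v

/-- A closed set is uncountable if and only if some nonempty set of balls meeting it is contained
in its own derivative. From such a set, one finds a point of the closed set outside any list by
choosing at each splitting the ball that avoids the next point of the list. Conversely, the balls
having uncountable intersection with the closed set are as required, as they contain two
condensation points. -/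
theorem countable_iff_forall_subset_deriv (F : Closeds X) :
    (F : Set X).Countable ↔ ∀ C ⊆ P.code F, C ⊆ P.deriv C → C = ∅ := by
  constructor
  · intro hF C hCF hC
    by_contra hne
    obtain ⟨n₀, hn₀⟩ := nonempty_iff_ne_empty.2 hne
    obtain ⟨x₀, -, hx₀⟩ := hCF hn₀
    obtain ⟨f, hf⟩ := hF.exists_eq_range ⟨x₀, hx₀⟩
    have hstep : ∀ (i : ℕ) (n : ℕ × ℕ), n ∈ C → ∃ m ∈ C, P.Prec n m ∧ f i ∉ P.closedBall m := by
      intro i n hn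
      obtain ⟨-, u, hu, v, hv, hnu, hnv, huv⟩ := hC hn
      by_cases h : f i ∈ P.closedBall u
      · exact ⟨v, hv, hnv, fun h' => (huv ▸ ⟨h, h'⟩ : f i ∈ (∅ : Set X))⟩
      · exact ⟨u, hu, hnu, h⟩
    choose! g hgC hg hgf using hstep
    let n : ℕ → ℕ × ℕ := fun k => Nat.rec n₀ (fun i m => g i m) k
    have hnC : ∀ k, n k ∈ C := by
      intro k
      induction k with
      | zero => exact hn₀
      | succ k ih => exact hgC k _ ih
    have hy : ∀ k, ∃ y, y ∈ P.ball (n k) ∧ y ∈ F := fun k => hCF (hnC k)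
    choose y hyn hyF using hy
    obtain ⟨x, hx, hxn, -⟩ := P.exists_tendsto_of_prec (fun k => hg k _ (hnC k)) hyn
    have hxF : x ∈ (F : Set X) := F.isClosed.mem_of_tendsto hx (Eventually.of_forall hyF)
    rw [hf] at hxF
    obtain ⟨i, rfl⟩ := hxF
    exact hgf i _ (hnC i) (P.ball_subset_closedBall _ (hxn (i + 1)))
  · intro h
    by_contra hF
    set C : Set (ℕ × ℕ) := {n | ¬ (P.ball n ∩ (F : Set X)).Countable}
    have hcond : ∀ n ∈ C,
        ¬ {x | x ∈ P.ball n ∩ (F : Set X) ∧ ∀ m, x ∈ P.ball m → m ∈ C}.Countable := by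
      intro n hn hc
      refine hn ((hc.union (countable_iUnion fun m : {m // m ∉ C} =>
        not_not.1 m.2)).mono fun x hx => ?_)
      by_cases hxC : ∀ m, x ∈ P.ball m → m ∈ C
      · exact .inl ⟨hx, hxC⟩
      · push Not at hxC
        obtain ⟨m, hxm, hm⟩ := hxC
        exact .inr (mem_iUnion.2 ⟨⟨m, hm⟩, hxm, hx.2⟩)
    have hCF : C ⊆ P.code F := by
      intro n hn
      by_contra hne
      refine hn ?_
      rw [not_nonempty_iff_eq_empty.1 hne]
      exact countable_empty
    have hCD : C ⊆ P.deriv C := by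
      intro n hn
      have hnt := not_subsingleton_iff.1 fun hs => hcond n hn hs.countable
      obtain ⟨x, ⟨⟨hxn, -⟩, hx⟩, y, ⟨⟨hyn, -⟩, hy⟩, hxy⟩ := hnt
      obtain ⟨U, V, hU, hV, hxU, hyV, hUV⟩ := P.t2Space.t2 hxy
      obtain ⟨u, hnu, hxu, huU⟩ := P.exists_prec hU hxU hxn
      obtain ⟨v, hnv, hyv, hvV⟩ := P.exists_prec hV hyV hyn
      exact ⟨hn, u, hx u hxu, v, hy v hyv, hnu, hnv, (hUV.mono huU hvV).inter_eq⟩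
    have hCne : C.Nonempty := by
      by_contra hne
      refine hF ((countable_iUnion (t := fun n => P.ball n ∩ (F : Set X)) fun n => ?_).mono
        fun x hx => ?_)
      · exact not_not.1 fun h => hne ⟨n, h⟩
      · obtain ⟨m, -, hxm, -⟩ := P.exists_ball isOpen_univ (mem_univ x) 0
        exact mem_iUnion.2 ⟨m, hxm, hx⟩
    exact hCne.ne_empty (h C hCF hCD)

theorem mem_countableClosed_iff (F : Closeds X) :
    F ∈ countableClosed X ↔
      iterDeriv (splitDeriv P.Split) (P.code F)
        (derivLength (splitDeriv P.Split) (P.code F)) = ∅ := by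
  rw [iterDeriv_derivLength_eq_empty_iff (splitDeriv_subset _) (splitDeriv_mono _)]
  exact P.countable_iff_forall_subset_deriv F

theorem exists_rank_le_iff (F : Closeds X) (o : Ordinal.{0}) :
    (∃ _ : F ∈ countableClosed X, P.rank F ≤ o) ↔
      iterDeriv (splitDeriv P.Split) (P.code F) o = ∅ := by
  rw [iterDeriv_eq_empty_iff (splitDeriv_subset _) (splitDeriv_mono _), exists_prop,
    P.mem_countableClosed_iff]
  rfl

/-! ### The co-analytic rank -/

include P in
theorem isCoanalytic_countableClosed : IsCoanalytic (countableClosed X) := by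
  have := P.standardBorelSpace_closeds
  have h : (countableClosed X)ᶜ = {F | ∃ C : Set (ℕ × ℕ), (∀ n, n ∈ C → n ∈ P.code F ∧
      ∃ u v, u ∈ C ∧ v ∈ C ∧ P.Split n u v) ∧ ∃ n, n ∈ C} := by
    ext F
    rw [mem_compl_iff, mem_ofPred_eq]
    refine (not_congr (P.countable_iff_forall_subset_deriv F)).trans ?_
    push Not
    refine exists_congr fun C => ?_
    constructor
    · rintro ⟨hCF, hC, hne⟩
      refine ⟨fun n hn => ⟨hCF hn, ?_⟩, hne⟩
      obtain ⟨-, u, hu, v, hv, h⟩ := hC hn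
      exact ⟨u, v, hu, hv, h⟩
    · rintro ⟨hC, hne⟩
      refine ⟨fun n hn => (hC n hn).1, fun n hn => ⟨hn, ?_⟩, hne⟩
      obtain ⟨-, u, v, hu, hv, h⟩ := hC n hn
      exact ⟨u, hu, v, hv, h⟩
  rw [IsCoanalytic, h]
  refine isAnalytic_setOf_exists ?_
  fun_prop

/-- On pairs of closed sets whose second member is countable, simulations describe the relation
"the first member is countable and of rank at most that of the second one". -/
theorem isAnalytic_exists_isSimulation :
    IsAnalytic {p : Closeds X × Closeds X | ∃ Z, IsSimulation P.Split (P.code p.1) (P.code p.2) Z ∧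
      ∀ n, n ∈ P.code p.1 → ∃ m, (n, m) ∈ Z} := by
  have := P.standardBorelSpace_closeds
  refine isAnalytic_setOf_exists ?_
  unfold IsSimulation
  fun_prop

/-- On pairs of closed sets whose second member is countable, strict simulations describe the
complement of the relation "the first member is countable and of rank at most that of the second
one". -/
theorem isAnalytic_exists_isStrictSimulation :
    IsAnalytic {p : Closeds X × Closeds X |
      ∃ W, IsStrictSimulation P.Split (P.code p.2) (P.code p.1) W ∧
        ∃ n, n ∈ P.code p.1 ∧ ∀ m, m ∈ P.code p.2 → (m, n) ∈ W} := by
  have := P.standardBorelSpace_closeds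
  refine isAnalytic_setOf_exists ?_
  unfold IsStrictSimulation
  fun_prop

end PolishPresentation

theorem mainTheorem1 {X : Type*} [TopologicalSpace X] [PolishSpace X]
    (P : PolishPresentation X) :
    (∀ F ∈ countableClosed X, P.rank F < Ordinal.omega 1) ∧
      IsCoanalyticRank (countableClosed X) (fun F => P.rank (F : Closeds X)) := by
  refine ⟨fun F _ => derivLength_lt_omega_one P.deriv_subset _, P.isCoanalytic_countableClosed,
    {p | ∃ W, IsStrictSimulation P.Split (P.code p.2) (P.code p.1) W ∧
      ∃ n, n ∈ P.code p.1 ∧ ∀ m, m ∈ P.code p.2 → (m, n) ∈ W}ᶜ,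
    {p | ∃ Z, IsSimulation P.Split (P.code p.1) (P.code p.2) Z ∧
      ∀ n, n ∈ P.code p.1 → ∃ m, (n, m) ∈ Z}, ?_, P.isAnalytic_exists_isSimulation, ?_⟩
  · rw [IsCoanalytic, compl_compl]
    exact P.isAnalytic_exists_isStrictSimulation
  · rintro ⟨E, hE⟩ F
    have hE' := (P.mem_countableClosed_iff E).1 hE
    have hle := P.exists_rank_le_iff F (P.rank E)
    refine ⟨Iff.trans ?_ hle.symm, Iff.trans (exists_isSimulation_iff hE') hle.symm⟩
    exact (not_congr (exists_isStrictSimulation_iff hE')).trans not_nonempty_iff_eq_empty
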